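/- **Setting.** Let $\pi:Q\to\mathbb R$ be a smooth ($C^\infty$) fibre bundle with $m$-dimensional fibres, with bundle coordinates $(t,q^i)$, where $t$ is the standard coordinate of $\mathbb R$. Let $J^1Q$ be the manifold of first order jets of its sections, identified with the submanifold of tangent vectors $v\in TQ$ such that $dt(v)=1$, with coordinates $(t,q^i,q^i_t)$. Let $V^*Q$ be the dual of the vertical tangent bundle $VQ=\ker dt$, with holonomic coordinates $(t,q^i,p_i)$. *Lagrangian side.* A Lagrangian is $L=\mathcal L(t,q^i,q^i_t)\,dt$ with $\mathcal L$ a smooth function on $J^1Q$. Put $\pi_i=\partial\mathcal L/\partial q^i_t$. The Legendre map $\widehat L:J^1Q\to V^*Q$ over $Q$ is given by $p_i\circ\widehat L=\pi_i$, and $N_L=\widehat L(J^1Q)\subset V^*Q$ is the Lagrangian constraint space. The Poincaré–Cartan form of $L$ is the one-form $$H_L=\pi_i\,dq^i-(\pi_iq^i_t-\mathcal L)\,dt$$ on $J^1Q$. The Lagrangian $L$ is *almost regular* if $N_L$ is a closed imbedded subbundle of $V^*Q\to Q$ and $\widehat L:J^1Q\to N_L$ is a surjective submersion with connected fibres. *Hamiltonian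 side.* A Hamiltonian form is a one-form $$H=p_i\,dq^i-\mathcal H(t,q^i,p_i)\,dt$$ on $V^*Q$ that is the pull-back of the Liouville form of $T^*Q$ by a smooth global section of $T^*Q\to V^*Q$; the Hamiltonian $\mathcal H$ is defined relative to each bundle coordinate chart. It defines the Hamiltonian map $\widehat H:V^*Q\to J^1Q$ over $Q$ by $q^i_t\circ\widehat H=\partial\mathcal H/\partial p_i$, and the density $L_H=(p_iq^i_t-\mathcal H)\,dt$ on $V^*Q\times_QJ^1Q$. The form $H$ is *weakly associated* with $L$ if * $\widehat L\circ\widehat H\circ\widehat L=\widehat L$, and * $\widehat H^*L_H=\widehat H^*L$ at all points of $N_L$, i.e. $p_i\,\frac{\partial\mathcal H}{\partial p_i}-\mathcal H=\mathcal L\big(t,q^j,\frac{\partial\mathcal H}{\partial p_j}\big)$ on $N_L$. **Theorem.** Let $L$ be an almost regular Lagrangian. Then: 1. any two Hamiltonian forms $H,H'$ weakly associated with $L$ coincide at every point of $N_L$; 2. for every Hamiltonian form $H$ weakly associated with $L$, the Poincaré–Cartan form of $L$ is the pull-back $$H_L=\widehat L^*H,\qquad\text{i.e.}\qquad \pi_iq^i_t-\mathcal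 L(t,q^j,q^j_t)=\mathcal H(t,q^j,\pi_j)$$ on $J^1Q$, in all bundle coordinates. -/

import Mathlib

open scoped Manifold ContDiff
open Set

noncomputable section

namespace Mechanics

universe u

/-- The model space `ℝ × ℝᵐ` of a configuration space, with coordinates `(t, qⁱ)`. -/
abbrev ConfModel (m : ℕ) : Type := ℝ × EuclideanSpace ℝ (Fin m)

section FibreBundle

variable {EY HY EB HB : Type*} [NormedAddCommGroup EY] [NormedSpace ℝ EY] [TopologicalSpace HY]
  [NormedAddCommGroup EB] [NormedSpace ℝ EB] [TopologicalSpace HB]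

/-- `p : Y → B` is a smooth fibre bundle whose typical fibre `V` is a `k`-dimensional manifold:
`p` is surjective and `B` is covered by open sets over which `Y` is diffeomorphic to the product
with `V`, over the identity of the base. -/
def IsSmoothFibreBundle (k : ℕ) (IY : ModelWithCorners ℝ EY HY) (IB : ModelWithCorners ℝ EB HB)
    {Y : Type u} {B : Type*} [TopologicalSpace Y] [ChartedSpace HY Y]
    [TopologicalSpace B] [ChartedSpace HB B] (p : Y → B) : Prop :=
  Function.Surjective p ∧
  ∃ (V : Type u) (_ : TopologicalSpace V) (_ : ChartedSpace (EuclideanSpace ℝ (Fin k)) V),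
    IsManifold (𝓡 k) ∞ V ∧
    ∀ b : B, ∃ e : Bundle.Trivialization V p, b ∈ e.baseSet ∧
      ContMDiffOn IY (IB.prod (𝓡 k)) ∞ e e.source ∧
      ContMDiffOn (IB.prod (𝓡 k)) IY ∞ e.toOpenPartialHomeomorph.symm e.target

end FibreBundle

variable (m : ℕ) {Q : Type u} [TopologicalSpace Q] [ChartedSpace (ConfModel m) Q]

/-- `π : Q → ℝ` is a smooth fibre bundle over the time axis with `m`-dimensional fibres. -/
class IsConfigurationBundle (π : Q → ℝ) : Prop where
  isSmoothFibreBundle : IsSmoothFibreBundle m 𝓘(ℝ, ConfModel m) 𝓘(ℝ, ℝ) π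

/-- Bundle coordinates `(t, qⁱ)` on an open subset of `Q`, with `t` the given time function. -/
structure BundleChart (π : Q → ℝ) where
  chart : OpenPartialHomeomorph Q (ConfModel m)
  mem_maximalAtlas : chart ∈ IsManifold.maximalAtlas 𝓘(ℝ, ConfModel m) ∞ Q
  fst_eq : ∀ q ∈ chart.source, (chart q).1 = π q

theorem exists_bundleChart [IsManifold 𝓘(ℝ, ConfModel m) ∞ Q] (π : Q → ℝ)
    [hπ : IsConfigurationBundle m π] (q : Q) :
    ∃ φ : BundleChart m π, q ∈ φ.chart.source := by
  obtain ⟨-, V, _, _, hV, h⟩ := hπ.isSmoothFibreBundle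
  obtain ⟨e, hb, he, he'⟩ := h (π q)
  let ψ := chartAt (EuclideanSpace ℝ (Fin m)) (e q).2
  have hq : q ∈ e.source := by rw [e.source_eq]; exact hb
  refine ⟨⟨e.toOpenPartialHomeomorph.trans ((OpenPartialHomeomorph.refl ℝ).prod ψ), ?_, ?_⟩, ?_⟩
  · apply OpenPartialHomeomorph.mem_maximalAtlas_of_contMDiffOn
    · have h1 : ContMDiffOn 𝓘(ℝ, ConfModel m) 𝓘(ℝ, ℝ) ∞ (fun y => (e y).1)
          (e.toOpenPartialHomeomorph.trans ((OpenPartialHomeomorph.refl ℝ).prod ψ)).source :=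
        (contMDiff_fst.comp_contMDiffOn he).mono (by intro y hy; simp at hy; exact hy.1)
      have h2 : ContMDiffOn 𝓘(ℝ, ConfModel m) (𝓡 m) ∞ (fun y => ψ (e y).2)
          (e.toOpenPartialHomeomorph.trans ((OpenPartialHomeomorph.refl ℝ).prod ψ)).source := by
        refine (contMDiffOn_chart (I := 𝓡 m) (n := ∞) (x := (e q).2)).comp
          ((contMDiff_snd.comp_contMDiffOn he).mono (by intro y hy; simp at hy; exact hy.1)) ?_
        intro y hy
        simp at hy
        exact hy.2
      exact h1.prodMk_space h2
    · have h1 : ContMDiffOn 𝓘(ℝ, ConfModel m) 𝓘(ℝ, ℝ) ∞ (fun x : ConfModel m => x.1)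
          (e.toOpenPartialHomeomorph.trans ((OpenPartialHomeomorph.refl ℝ).prod ψ)).target :=
        contDiff_fst.contMDiff.contMDiffOn
      have h2 : ContMDiffOn 𝓘(ℝ, ConfModel m) (𝓡 m) ∞ (fun x : ConfModel m => ψ.symm x.2)
          (e.toOpenPartialHomeomorph.trans ((OpenPartialHomeomorph.refl ℝ).prod ψ)).target := by
        refine (contMDiffOn_chart_symm (I := 𝓡 m) (n := ∞) (x := (e q).2)).comp
          contDiff_snd.contMDiff.contMDiffOn ?_
        intro y hy
        simp at hy
        exact hy.1
      refine he'.comp (h1.prodMk h2) ?_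
      intro y hy
      simp only [OpenPartialHomeomorph.trans_target] at hy
      exact hy.2
  · intro y hy
    simp only [OpenPartialHomeomorph.trans_source] at hy
    exact e.proj_toFun y hy.1
  · simp only [OpenPartialHomeomorph.trans_source]
    refine ⟨hq, ?_⟩
    simp [ψ]

/-- The norm that the tangent spaces of `Q` inherit from the model space. It induces their standard
topology, and is only used to differentiate maps between finite-dimensional vector spaces. -/
instance (q : Q) : NormedAddCommGroup (TangentSpace 𝓘(ℝ, ConfModel m) q) :=
  inferInstanceAs (NormedAddCommGroup (ConfModel m))

instance (q : Q) : NormedSpace ℝ (TangentSpace 𝓘(ℝ, ConfModel m) q) :=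
  inferInstanceAs (NormedSpace ℝ (ConfModel m))

/-- The one-form `dt` on `Q`. -/
def dt (π : Q → ℝ) (q : Q) : TangentSpace 𝓘(ℝ, ConfModel m) q →L[ℝ] ℝ :=
  mfderiv 𝓘(ℝ, ConfModel m) 𝓘(ℝ, ℝ) π q

/-- The fibre `V_q Q = ker T_q π` of the vertical tangent bundle. -/
abbrev Vert (π : Q → ℝ) (q : Q) : Submodule ℝ (TangentSpace 𝓘(ℝ, ConfModel m) q) :=
  (dt m π q).ker

/-- The first order jet manifold `J¹Q`, identified with its canonical image in `TQ`: the tangent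
vectors `∂_t + qⁱ_t ∂_i` to `Q`, that is, those on which `dt` is equal to `1`. -/
@[ext]
structure JetSpace (π : Q → ℝ) where
  pt : Q
  vel : TangentSpace 𝓘(ℝ, ConfModel m) pt
  dt_vel : dt m π pt vel = 1

/-- The vertical cotangent bundle `V*Q`, the dual of the vertical tangent bundle `VQ`. -/
@[ext]
structure VCotangent (π : Q → ℝ) where
  pt : Q
  mom : Vert m π pt →L[ℝ] ℝ

variable {m}

namespace BundleChart

variable {π : Q → ℝ} (φ φ' : BundleChart m π) (q : Q)

/-- The components `(ṫ, q̇ⁱ)` of a tangent vector to `Q`. -/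
def coord : TangentSpace 𝓘(ℝ, ConfModel m) q →L[ℝ] ConfModel m :=
  mfderiv 𝓘(ℝ, ConfModel m) 𝓘(ℝ, ConfModel m) φ.chart q

/-- The tangent vector `ṫ ∂_t + q̇ⁱ ∂_i` with given components, at a point of the chart domain: the
inverse of `coord`. -/
def frame : ConfModel m →L[ℝ] TangentSpace 𝓘(ℝ, ConfModel m) q :=
  (φ.coord q).inverse

section

variable {φ φ' q}

theorem mdifferentiable :
    φ.chart.MDifferentiable 𝓘(ℝ, ConfModel m) 𝓘(ℝ, ConfModel m) :=
  ⟨(contMDiffOn_of_mem_maximalAtlas φ.mem_maximalAtlas).mdifferentiableOn (by simp),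
    (contMDiffOn_symm_of_mem_maximalAtlas φ.mem_maximalAtlas).mdifferentiableOn (by simp)⟩

theorem coord_isInvertible (hq : q ∈ φ.chart.source) : (φ.coord q).IsInvertible :=
  ⟨φ.mdifferentiable.mfderiv hq, rfl⟩

theorem coord_frame (hq : q ∈ φ.chart.source) (x : ConfModel m) :
    φ.coord q (φ.frame q x) = x :=
  (coord_isInvertible hq).self_apply_inverse x

theorem frame_coord (hq : q ∈ φ.chart.source) (v : TangentSpace 𝓘(ℝ, ConfModel m) q) :
    φ.frame q (φ.coord q v) = v :=
  (coord_isInvertible hq).inverse_apply_self v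

theorem dt_eq (hq : q ∈ φ.chart.source) (v : TangentSpace 𝓘(ℝ, ConfModel m) q) :
    dt m π q v = (φ.coord q v).1 := by
  have h1 : mfderiv 𝓘(ℝ, ConfModel m) 𝓘(ℝ, ℝ) π q =
      mfderiv 𝓘(ℝ, ConfModel m) 𝓘(ℝ, ℝ) (Prod.fst ∘ φ.chart) q := by
    apply Filter.EventuallyEq.mfderiv_eq
    filter_upwards [φ.chart.open_source.mem_nhds hq] with y hy
    exact (φ.fst_eq y hy).symm
  have h2 : mfderiv 𝓘(ℝ, ConfModel m) 𝓘(ℝ, ℝ) (Prod.fst : ConfModel m → ℝ) (φ.chart q)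
      = ContinuousLinearMap.fst ℝ ℝ (EuclideanSpace ℝ (Fin m)) := by
    rw [mfderiv_eq_fderiv]
    exact fderiv_fst
  rw [mfderiv_comp q (I' := 𝓘(ℝ, ConfModel m))
    (differentiableAt_fst.mdifferentiableAt) (φ.mdifferentiable.mdifferentiableAt hq)] at h1
  unfold dt coord
  rw [h1, h2]
  rfl

theorem dt_frame (hq : q ∈ φ.chart.source) (x : ConfModel m) : dt m π q (φ.frame q x) = x.1 := by
  rw [dt_eq hq, coord_frame hq]

variable (φ φ') in
/-- The transition functions between two systems of bundle coordinates. -/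
def trans : OpenPartialHomeomorph (ConfModel m) (ConfModel m) := φ.chart.symm.trans φ'.chart

theorem contDiffOn_trans : ContDiffOn ℝ ∞ (trans φ φ') (trans φ φ').source := by
  rw [← contMDiffOn_iff_contDiffOn]
  exact contMDiffOn_of_mem_contDiffGroupoid
    ((contDiffGroupoid ∞ 𝓘(ℝ, ConfModel m)).compatible_of_mem_maximalAtlas
      φ.mem_maximalAtlas φ'.mem_maximalAtlas)

theorem contDiffOn_fderiv_trans :
    ContDiffOn ℝ ∞ (fderiv ℝ (trans φ φ')) (trans φ φ').source :=
  contDiffOn_trans.fderiv_of_isOpen (trans φ φ').open_source (by simp)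

theorem coord_frame_trans (hq : q ∈ φ.chart.source) (hq' : q ∈ φ'.chart.source)
    (x : ConfModel m) :
    φ'.coord q (φ.frame q x) = fderiv ℝ (trans φ φ') (φ.chart q) x := by
  have hx : φ.chart q ∈ φ.chart.target := φ.chart.map_source hq
  have e : φ.chart.symm (φ.chart q) = q := φ.chart.left_inv hq
  obtain ⟨v, rfl⟩ := (coord_isInvertible hq).surjective x
  rw [frame_coord hq, ← mfderiv_eq_fderiv]
  have hd : MDifferentiableAt 𝓘(ℝ, ConfModel m) 𝓘(ℝ, ConfModel m) (trans φ φ') (φ.chart q) := by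
    have hs : φ.chart q ∈ (trans φ φ').source := by
      simp only [trans, OpenPartialHomeomorph.trans_source]
      exact ⟨hx, by simpa [e] using hq'⟩
    exact ((contDiffOn_trans.contDiffAt ((trans φ φ').open_source.mem_nhds hs)).differentiableAt
      (by simp)).mdifferentiableAt
  have h := mfderiv_comp q hd (φ.mdifferentiable.mdifferentiableAt hq)
  have h' : mfderiv 𝓘(ℝ, ConfModel m) 𝓘(ℝ, ConfModel m) φ'.chart q =
      mfderiv 𝓘(ℝ, ConfModel m) 𝓘(ℝ, ConfModel m) (trans φ φ' ∘ φ.chart) q := by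
    apply Filter.EventuallyEq.mfderiv_eq
    filter_upwards [φ.chart.open_source.mem_nhds hq] with y hy
    simp [trans, φ.chart.left_inv hy]
  unfold coord
  rw [h', h]
  rfl

end

end BundleChart

section JetManifold

variable [IsManifold 𝓘(ℝ, ConfModel m) ∞ Q] {π : Q → ℝ} [IsConfigurationBundle m π]

theorem exists_jet (q : Q) : ∃ z : JetSpace m π, z.pt = q := by
  obtain ⟨φ, hφ⟩ := exists_bundleChart m π q
  exact ⟨⟨q, φ.frame q (1, 0), φ.dt_frame hφ _⟩, rfl⟩

open Classical in
/-- The jet with adapted coordinates `x = (t, qⁱ, qⁱ_t)`; a junk value outside of the range of the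
bundle coordinates. -/
def jetOfCoord (φ : BundleChart m π) (x : ConfModel m × EuclideanSpace ℝ (Fin m)) :
    JetSpace m π :=
  if h : φ.chart.symm x.1 ∈ φ.chart.source then
    ⟨φ.chart.symm x.1, φ.frame _ (1, x.2), φ.dt_frame h _⟩
  else (exists_jet (π := π) (φ.chart.symm x.1)).choose

theorem jetOfCoord_pt (φ : BundleChart m π) (x : ConfModel m × EuclideanSpace ℝ (Fin m)) :
    (jetOfCoord φ x).pt = φ.chart.symm x.1 := by
  unfold jetOfCoord
  split_ifs with h
  · rfl
  · exact (exists_jet (π := π) (φ.chart.symm x.1)).choose_spec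

theorem jetOfCoord_of_mem (φ : BundleChart m π) {x : ConfModel m × EuclideanSpace ℝ (Fin m)}
    (h : φ.chart.symm x.1 ∈ φ.chart.source) :
    jetOfCoord φ x = ⟨φ.chart.symm x.1, φ.frame _ (1, x.2), φ.dt_frame h _⟩ :=
  dif_pos h

/-- The adapted coordinates `(t, qⁱ, qⁱ_t)` on `J¹Q`. -/
def jetChart (φ : BundleChart m π) :
    PartialEquiv (JetSpace m π) (ConfModel m × EuclideanSpace ℝ (Fin m)) where
  toFun z := (φ.chart z.pt, (φ.coord z.pt z.vel).2)
  invFun := jetOfCoord φ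
  source := {z | z.pt ∈ φ.chart.source}
  target := φ.chart.target ×ˢ univ
  map_source' z hz := ⟨φ.chart.map_source hz, mem_univ _⟩
  map_target' x hx := by
    show (jetOfCoord φ x).pt ∈ φ.chart.source
    rw [jetOfCoord_pt]
    exact φ.chart.map_target hx.1
  left_inv' z hz := by
    obtain ⟨q, v, hv⟩ := z
    have hz : q ∈ φ.chart.source := hz
    have hv' : ((1 : ℝ), (φ.coord q v).2) = φ.coord q v :=
      Prod.ext (by rw [← hv, BundleChart.dt_eq hz]) rfl
    have e := φ.chart.left_inv hz
    rw [jetOfCoord_of_mem φ (by rw [e]; exact hz)]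
    simp only [hv']
    have key : ∀ q', q' = q → ∀ h, (⟨q', φ.frame q' (φ.coord q v), h⟩ : JetSpace m π) =
        ⟨q, v, hv⟩ := by
      rintro _ rfl h
      simp only [BundleChart.frame_coord hz]
    exact key _ e _
  right_inv' x hx := by
    have h := φ.chart.map_target hx.1
    rw [jetOfCoord_of_mem φ h]
    simp only [BundleChart.coord_frame h, φ.chart.right_inv hx.1]

/-- The transition functions of adapted coordinates on `J¹Q`. -/
theorem jetChart_trans (φ φ' : BundleChart m π) :
    ((jetChart φ).symm.trans (jetChart φ')).source = (φ.trans φ').source ×ˢ univ ∧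
    ContDiffOn ℝ ∞ ((jetChart φ).symm.trans (jetChart φ'))
      ((jetChart φ).symm.trans (jetChart φ')).source := by
  have hs : ((jetChart φ).symm.trans (jetChart φ')).source = (φ.trans φ').source ×ˢ univ := by
    ext x
    have : x ∈ ((jetChart φ).symm.trans (jetChart φ')).source ↔
        (x.1 ∈ φ.chart.target ∧ x.2 ∈ univ) ∧ (jetOfCoord φ x).pt ∈ φ'.chart.source := Iff.rfl
    rw [this, jetOfCoord_pt]
    simp [BundleChart.trans]
  refine ⟨hs, ?_⟩
  rw [hs]
  have h1 : ContDiffOn ℝ ∞ (fun x : ConfModel m × EuclideanSpace ℝ (Fin m) =>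
      (φ.trans φ' x.1, (fderiv ℝ (φ.trans φ') x.1 ((1 : ℝ), x.2)).2))
      ((φ.trans φ').source ×ˢ univ) := by
    have hm : MapsTo Prod.fst ((φ.trans φ').source ×ˢ (univ : Set (EuclideanSpace ℝ (Fin m))))
      (φ.trans φ').source := fun x hx => hx.1
    refine (BundleChart.contDiffOn_trans.comp contDiffOn_fst hm).prodMk
      (contDiff_snd.comp_contDiffOn
        ((BundleChart.contDiffOn_fderiv_trans.comp contDiffOn_fst hm).clm_apply
          (contDiffOn_const.prodMk contDiffOn_snd)))
  refine h1.congr fun x hx => ?_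
  have hx1 : x.1 ∈ φ.chart.target := hx.1.1
  have h := φ.chart.map_target hx1
  have h' : φ.chart.symm x.1 ∈ φ'.chart.source := hx.1.2
  have e : φ.chart (φ.chart.symm x.1) = x.1 := φ.chart.right_inv hx1
  show (φ'.chart (jetOfCoord φ x).pt, (φ'.coord _ (jetOfCoord φ x).vel).2) = _
  rw [jetOfCoord_of_mem φ h]
  simp only [BundleChart.coord_frame_trans h h', e]
  rfl

/-- The atlas of adapted coordinates on `J¹Q`. -/
def jetCore (π : Q → ℝ) [IsConfigurationBundle m π] :
    ChartedSpaceCore (ConfModel m × EuclideanSpace ℝ (Fin m)) (JetSpace m π) where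
  atlas := range jetChart
  chartAt z := jetChart (exists_bundleChart m π z.pt).choose
  mem_chart_source z := (exists_bundleChart m π z.pt).choose_spec
  chart_mem_atlas _ := mem_range_self _
  open_source := by
    rintro _ _ ⟨φ, rfl⟩ ⟨φ', rfl⟩
    rw [(jetChart_trans φ φ').1]
    exact (φ.trans φ').open_source.prod isOpen_univ
  continuousOn_toFun := by
    rintro _ _ ⟨φ, rfl⟩ ⟨φ', rfl⟩
    exact (jetChart_trans φ φ').2.continuousOn

instance : TopologicalSpace (JetSpace m π) := (jetCore π).toTopologicalSpace

instance : ChartedSpace (ConfModel m × EuclideanSpace ℝ (Fin m)) (JetSpace m π) :=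
  (jetCore π).toChartedSpace

instance : IsManifold 𝓘(ℝ, ConfModel m × EuclideanSpace ℝ (Fin m)) ∞ (JetSpace m π) := by
  apply isManifold_of_contDiffOn
  intro e e' he he'
  obtain ⟨c, hc⟩ := mem_iUnion.1 he
  obtain ⟨⟨φ, rfl⟩, rfl⟩ := mem_iUnion.1 hc
  obtain ⟨c', hc'⟩ := mem_iUnion.1 he'
  obtain ⟨⟨φ', rfl⟩, rfl⟩ := mem_iUnion.1 hc'
  exact (jetChart_trans φ φ').2.mono fun x hx => hx.1

end JetManifold

section PhaseManifold

variable {π : Q → ℝ}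

namespace BundleChart

variable (φ : BundleChart m π) {q : Q}

/-- The vertical tangent vector `q̇ⁱ ∂_i`. -/
def vframe (hq : q ∈ φ.chart.source) : EuclideanSpace ℝ (Fin m) →L[ℝ] Vert m π q :=
  ((φ.frame q).comp (ContinuousLinearMap.inr ℝ ℝ (EuclideanSpace ℝ (Fin m)))).codRestrict
    (Vert m π q) fun w => by
      show dt m π q (φ.frame q (0, w)) = 0
      rw [dt_frame hq]

/-- The components `q̇ⁱ` of a vertical tangent vector; its `i`-th component is the covector
`d̄qⁱ`. -/
def vcoord (q : Q) : Vert m π q →L[ℝ] EuclideanSpace ℝ (Fin m) :=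
  ((ContinuousLinearMap.snd ℝ ℝ (EuclideanSpace ℝ (Fin m))).comp (φ.coord q)).comp
    (Vert m π q).subtypeL

variable {φ}

theorem vcoord_vframe (hq : q ∈ φ.chart.source) (w : EuclideanSpace ℝ (Fin m)) :
    φ.vcoord q (φ.vframe hq w) = w := by
  show (φ.coord q (φ.frame q (0, w))).2 = w
  rw [coord_frame hq]

theorem vframe_vcoord (hq : q ∈ φ.chart.source) (v : Vert m π q) :
    φ.vframe hq (φ.vcoord q v) = v := by
  apply Subtype.ext
  show φ.frame q (0, (φ.coord q v).2) = v
  have hv : ((0 : ℝ), (φ.coord q v).2) = φ.coord q v :=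
    Prod.ext (by rw [← dt_eq hq]; exact v.2.symm) rfl
  rw [hv, frame_coord hq]

end BundleChart

variable [IsManifold 𝓘(ℝ, ConfModel m) ∞ Q]

open Classical in
/-- The holonomic coordinates `(t, qⁱ, p_i)` on `V*Q`; the momenta `p_i` are the components of a
linear form on `ℝᵐ`. -/
def phaseChart (φ : BundleChart m π) :
    PartialEquiv (VCotangent m π) (ConfModel m × (EuclideanSpace ℝ (Fin m) →L[ℝ] ℝ)) where
  toFun p := (φ.chart p.pt, if h : p.pt ∈ φ.chart.source then p.mom.comp (φ.vframe h) else 0)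
  invFun x := ⟨φ.chart.symm x.1, x.2.comp (φ.vcoord _)⟩
  source := {p | p.pt ∈ φ.chart.source}
  target := φ.chart.target ×ˢ univ
  map_source' p hp := ⟨φ.chart.map_source hp, mem_univ _⟩
  map_target' x hx := φ.chart.map_target hx.1
  left_inv' p hp := by
    obtain ⟨q, a⟩ := p
    have hp : q ∈ φ.chart.source := hp
    have h : (a.comp (φ.vframe hp)).comp (φ.vcoord q) = a := by
      ext v
      simp [BundleChart.vframe_vcoord hp]
    simp only [hp, dif_pos]
    have key : ∀ q', q' = q → ∀ b : EuclideanSpace ℝ (Fin m) →L[ℝ] ℝ,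
        b.comp (φ.vcoord q) = a → (⟨q', b.comp (φ.vcoord q')⟩ : VCotangent m π) = ⟨q, a⟩ := by
      rintro _ rfl b rfl
      rfl
    exact key _ (φ.chart.left_inv hp) _ h
  right_inv' x hx := by
    have h := φ.chart.map_target hx.1
    refine Prod.ext (φ.chart.right_inv hx.1) ?_
    simp only [h, dif_pos]
    ext w
    simp [BundleChart.vcoord_vframe h]

theorem phaseChart_trans (φ φ' : BundleChart m π) :
    ((phaseChart φ).symm.trans (phaseChart φ')).source = (φ.trans φ').source ×ˢ univ ∧
    ContDiffOn ℝ ∞ ((phaseChart φ).symm.trans (phaseChart φ'))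
      ((phaseChart φ).symm.trans (phaseChart φ')).source := by
  have hs : ((phaseChart φ).symm.trans (phaseChart φ')).source =
      (φ.trans φ').source ×ˢ univ := by
    ext x
    have : x ∈ ((phaseChart φ).symm.trans (phaseChart φ')).source ↔
        (x.1 ∈ φ.chart.target ∧ x.2 ∈ univ) ∧ φ.chart.symm x.1 ∈ φ'.chart.source := Iff.rfl
    rw [this]
    simp [BundleChart.trans]
  refine ⟨hs, ?_⟩
  rw [hs]
  have hm : MapsTo Prod.fst ((φ.trans φ').source ×ˢ
      (univ : Set (EuclideanSpace ℝ (Fin m) →L[ℝ] ℝ))) (φ.trans φ').source := fun x hx => hx.1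
  have h2 : ContDiffOn ℝ ∞ (fun x : ConfModel m × (EuclideanSpace ℝ (Fin m) →L[ℝ] ℝ) =>
      fderiv ℝ (φ'.trans φ) (φ.trans φ' x.1)) ((φ.trans φ').source ×ˢ univ) := by
    refine BundleChart.contDiffOn_fderiv_trans.comp
      (BundleChart.contDiffOn_trans.comp contDiffOn_fst hm) fun x hx => ?_
    have h : φ.trans φ' x.1 ∈ (φ.trans φ').target := (φ.trans φ').map_source hx.1
    simpa [BundleChart.trans, OpenPartialHomeomorph.trans_target, and_comm] using h
  have h1 : ContDiffOn ℝ ∞ (fun x : ConfModel m × (EuclideanSpace ℝ (Fin m) →L[ℝ] ℝ) =>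
      (φ.trans φ' x.1, x.2.comp ((ContinuousLinearMap.snd ℝ ℝ (EuclideanSpace ℝ (Fin m))).comp
        ((fderiv ℝ (φ'.trans φ) (φ.trans φ' x.1)).comp
          (ContinuousLinearMap.inr ℝ ℝ (EuclideanSpace ℝ (Fin m)))))))
      ((φ.trans φ').source ×ˢ univ) :=
    (BundleChart.contDiffOn_trans.comp contDiffOn_fst hm).prodMk
      (contDiffOn_snd.clm_comp (contDiffOn_const.clm_comp (h2.clm_comp contDiffOn_const)))
  refine h1.congr fun x hx => ?_
  have hx1 : x.1 ∈ φ.chart.target := hx.1.1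
  have h := φ.chart.map_target hx1
  have h' : φ.chart.symm x.1 ∈ φ'.chart.source := hx.1.2
  refine Prod.ext rfl ((dif_pos h').trans ?_)
  ext w
  show x.2 ((φ.coord _ (φ'.frame _ (0, w))).2) = _
  rw [BundleChart.coord_frame_trans h' h]
  rfl

variable [IsConfigurationBundle m π]

/-- The atlas of holonomic coordinates on `V*Q`. -/
def phaseCore (π : Q → ℝ) [IsConfigurationBundle m π] :
    ChartedSpaceCore (ConfModel m × (EuclideanSpace ℝ (Fin m) →L[ℝ] ℝ)) (VCotangent m π) where
  atlas := range phaseChart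
  chartAt p := phaseChart (exists_bundleChart m π p.pt).choose
  mem_chart_source p := (exists_bundleChart m π p.pt).choose_spec
  chart_mem_atlas _ := mem_range_self _
  open_source := by
    rintro _ _ ⟨φ, rfl⟩ ⟨φ', rfl⟩
    rw [(phaseChart_trans φ φ').1]
    exact (φ.trans φ').open_source.prod isOpen_univ
  continuousOn_toFun := by
    rintro _ _ ⟨φ, rfl⟩ ⟨φ', rfl⟩
    exact (phaseChart_trans φ φ').2.continuousOn

instance : TopologicalSpace (VCotangent m π) := (phaseCore π).toTopologicalSpace

instance : ChartedSpace (ConfModel m × (EuclideanSpace ℝ (Fin m) →L[ℝ] ℝ)) (VCotangent m π) :=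
  (phaseCore π).toChartedSpace

instance : IsManifold 𝓘(ℝ, ConfModel m × (EuclideanSpace ℝ (Fin m) →L[ℝ] ℝ)) ∞
    (VCotangent m π) := by
  apply isManifold_of_contDiffOn
  intro e e' he he'
  obtain ⟨c, hc⟩ := mem_iUnion.1 he
  obtain ⟨⟨φ, rfl⟩, rfl⟩ := mem_iUnion.1 hc
  obtain ⟨c', hc'⟩ := mem_iUnion.1 he'
  obtain ⟨⟨φ', rfl⟩, rfl⟩ := mem_iUnion.1 hc'
  exact (phaseChart_trans φ φ').2.mono fun x hx => hx.1

end PhaseManifold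

section OneForm

variable {E H E' H' : Type*} [NormedAddCommGroup E] [NormedSpace ℝ E] [TopologicalSpace H]
  [NormedAddCommGroup E'] [NormedSpace ℝ E'] [TopologicalSpace H']

/-- One-forms on a manifold. -/
abbrev OneForm (I : ModelWithCorners ℝ E H) (M : Type*) [TopologicalSpace M]
    [ChartedSpace H M] : Type _ :=
  ∀ x : M, TangentSpace I x →L[ℝ] ℝ

/-- The pull-back `f^* θ` of a one-form. -/
def OneForm.pullback {I : ModelWithCorners ℝ E H} {I' : ModelWithCorners ℝ E' H'}
    {M N : Type*} [TopologicalSpace M] [ChartedSpace H M] [TopologicalSpace N]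
    [ChartedSpace H' N] (θ : OneForm I' N) (f : M → N) : OneForm I M :=
  fun x => (θ (f x)).comp (mfderiv I I' f x)

end OneForm

section Cotangent

variable (m) (Q)

/-- The cotangent bundle `T*Q`. -/
abbrev Cotangent : Type _ :=
  Bundle.TotalSpace (ConfModel m →L[ℝ] ℝ)
    (fun q : Q => TangentSpace 𝓘(ℝ, ConfModel m) q →L[ℝ] Bundle.Trivial Q ℝ q)

/-- The model with corners of the `2(m + 1)`-dimensional manifold `T*Q`. -/
abbrev cotangentModel :
    ModelWithCorners ℝ (ConfModel m × (ConfModel m →L[ℝ] ℝ))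
      (ModelProd (ConfModel m) (ConfModel m →L[ℝ] ℝ)) :=
  𝓘(ℝ, ConfModel m).prod 𝓘(ℝ, ConfModel m →L[ℝ] ℝ)

/-- The Liouville form `Ξ = p₀ dt + p_i dqⁱ` on `T*Q`. -/
def liouville [IsManifold 𝓘(ℝ, ConfModel m) ∞ Q] : OneForm (cotangentModel m) (Cotangent m Q) :=
  fun α => ContinuousLinearMap.comp (α.snd : TangentSpace 𝓘(ℝ, ConfModel m) α.proj →L[ℝ] ℝ)
    (mfderiv (cotangentModel m) 𝓘(ℝ, ConfModel m) (fun β : Cotangent m Q => β.proj) α)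

end Cotangent

variable (m)

/-- The model of the manifold `J¹Q`. -/
abbrev jetModel := 𝓘(ℝ, ConfModel m × EuclideanSpace ℝ (Fin m))

/-- The model of the manifold `V*Q`. -/
abbrev phaseModel := 𝓘(ℝ, ConfModel m × (EuclideanSpace ℝ (Fin m) →L[ℝ] ℝ))

variable [IsManifold 𝓘(ℝ, ConfModel m) ∞ Q]

/-- A first order Lagrangian `L = ℒ dt` on the velocity space `J¹Q`. -/
structure Lagrangian (π : Q → ℝ) [IsConfigurationBundle m π] where
  density : JetSpace m π → ℝ
  smooth : ContMDiff (jetModel m) 𝓘(ℝ, ℝ) ∞ density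

/-- A Hamiltonian form `H = p_i dqⁱ - ℋ dt` on the phase space `V*Q`. It is given by a smooth global
section `p ↦ (p.pt, cov p)` of the projection `T*Q → V*Q` that restricts a covector to `VQ`. -/
structure HamiltonianForm (π : Q → ℝ) [IsConfigurationBundle m π] where
  cov (p : VCotangent m π) : TangentSpace 𝓘(ℝ, ConfModel m) p.pt →L[ℝ] ℝ
  cov_vert (p : VCotangent m π) : (cov p).comp (Vert m π p.pt).subtypeL = p.mom
  smooth : ContMDiff (phaseModel m) (cotangentModel m) ∞
    (fun p => (⟨p.pt, cov p⟩ : Cotangent m Q))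

variable {m} {π : Q → ℝ}

namespace JetSpace

/-- The jet bundle `J¹Q → Q` is affine, modelled over `VQ`. -/
def addVert (z : JetSpace m π) (w : Vert m π z.pt) : JetSpace m π :=
  ⟨z.pt, z.vel + w, by
    have hw : dt m π z.pt w = 0 := w.2
    rw [map_add, z.dt_vel, hw, add_zero]⟩

/-- The projection `T_q Q → V_q Q` along the jet `z`, that is, `(dqⁱ - qⁱ_t dt) ⊗ ∂_i`. -/
def vertPart (z : JetSpace m π) : TangentSpace 𝓘(ℝ, ConfModel m) z.pt →L[ℝ] Vert m π z.pt :=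
  (ContinuousLinearMap.id ℝ _ - (dt m π z.pt).smulRight z.vel).codRestrict (Vert m π z.pt)
    fun u => by
      show dt m π z.pt (u - dt m π z.pt u • z.vel) = 0
      rw [map_sub, map_smul, z.dt_vel, smul_eq_mul, mul_one, sub_self]

end JetSpace

variable [IsConfigurationBundle m π]

namespace Lagrangian

variable (L : Lagrangian m π)

/-- The Legendre map `L̂ : J¹Q → V*Q`, `p_i ∘ L̂ = π_i = ∂ℒ/∂qⁱ_t`: the derivative of `ℒ` along the
fibres of `J¹Q → Q`. -/
def legendre (z : JetSpace m π) : VCotangent m π :=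
  ⟨z.pt, fderiv ℝ (fun w : Vert m π z.pt => L.density (z.addVert w)) 0⟩

/-- The Lagrangian constraint space `N_L`. -/
def constraintSpace : Set (VCotangent m π) := range L.legendre

/-- The Legendre map as a map onto the Lagrangian constraint space. -/
def legendreOnto : JetSpace m π → L.constraintSpace := rangeFactorization L.legendre

/-- The Poincaré–Cartan form `H_L = π_i dqⁱ - (π_i qⁱ_t - ℒ) dt = π_i (dqⁱ - qⁱ_t dt) + ℒ dt` on
`J¹Q`. -/
def poincareCartan : OneForm (jetModel m) (JetSpace m π) := fun z =>
  ((L.legendre z).mom.comp z.vertPart + L.density z • dt m π z.pt).comp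
    (mfderiv (jetModel m) 𝓘(ℝ, ConfModel m) (fun y : JetSpace m π => y.pt) z)

/-- `L` is almost regular: `N_L` is a closed imbedded submanifold of `V*Q` and a fibre bundle over
`Q` (a closed imbedded subbundle of `V*Q → Q`), and `L̂ : J¹Q → N_L` is a surjective submersion with
connected fibres. -/
def IsAlmostRegular : Prop :=
  IsClosed L.constraintSpace ∧
  ∃ (d r : ℕ) (_ : ChartedSpace (EuclideanSpace ℝ (Fin d)) L.constraintSpace),
    IsManifold (𝓡 d) ∞ L.constraintSpace ∧
    Manifold.IsSmoothEmbedding (𝓡 d) (phaseModel m) ∞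
      (Subtype.val : L.constraintSpace → VCotangent m π) ∧
    IsSmoothFibreBundle r (𝓡 d) 𝓘(ℝ, ConfModel m)
      (fun p : L.constraintSpace => (p : VCotangent m π).pt) ∧
    Manifold.IsSubmersion (jetModel m) (𝓡 d) ∞ L.legendreOnto ∧
    ∀ p ∈ L.constraintSpace, IsConnected (L.legendre ⁻¹' {p})

end Lagrangian

namespace HamiltonianForm

variable (H : HamiltonianForm m π)

/-- The section of `T*Q → V*Q` that defines `H`. -/
def sec (p : VCotangent m π) : Cotangent m Q := ⟨p.pt, H.cov p⟩

/-- `H` as a one-form on `V*Q`: the pull-back of the Liouville form by the section. -/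
def form : OneForm (phaseModel m) (VCotangent m π) :=
  OneForm.pullback (liouville m Q) H.sec

/-- The function `ℋ` such that `H = p_i dqⁱ - ℋ dt` in bundle coordinates. -/
def ham (φ : BundleChart m π) (p : VCotangent m π) : ℝ :=
  -H.cov p (φ.frame p.pt (1, 0))

/-- The partial derivative `∂ⁱℋ = ∂ℋ/∂p_i` in bundle coordinates. -/
def dham (φ : BundleChart m π) (p : VCotangent m π) (i : Fin m) : ℝ :=
  fderiv ℝ (fun a : Vert m π p.pt →L[ℝ] ℝ => H.ham φ ⟨p.pt, a⟩) p.mom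
    ((EuclideanSpace.proj i).comp (φ.vcoord p.pt))

/-- The Hamiltonian map `Ĥ : V*Q → J¹Q`, `qⁱ_t ∘ Ĥ = ∂ⁱℋ`. -/
def hamiltonianMap (p : VCotangent m π) : JetSpace m π :=
  ⟨p.pt, (exists_bundleChart m π p.pt).choose.frame p.pt
      (1, WithLp.toLp 2 (H.dham (exists_bundleChart m π p.pt).choose p)),
    BundleChart.dt_frame (exists_bundleChart m π p.pt).choose_spec _⟩

/-- The coefficient `p_i qⁱ_t - ℋ` of the Lagrangian `L_H = h₀(H)` on `V*Q ×_Q J¹Q`: the contraction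
of `H` with the tangent vector `∂_t + qⁱ_t ∂_i`. -/
def lagrangian (p : VCotangent m π) (v : TangentSpace 𝓘(ℝ, ConfModel m) p.pt) : ℝ := H.cov p v

/-- `H` is weakly associated with `L`: `L̂ ∘ Ĥ ∘ L̂ = L̂`, and `Ĥ^* L_H = Ĥ^* L` on `N_L`. -/
structure IsWeaklyAssociated (L : Lagrangian m π) : Prop where
  legendre_hamiltonianMap : ∀ z, L.legendre (H.hamiltonianMap (L.legendre z)) = L.legendre z
  density_eq : ∀ p ∈ L.constraintSpace,
    H.lagrangian p (H.hamiltonianMap p).vel = L.density (H.hamiltonianMap p)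

end HamiltonianForm


namespace HamiltonianForm

variable (H : HamiltonianForm m π)

theorem differentiable_cov {q : Q} (v : TangentSpace 𝓘(ℝ, ConfModel m) q) :
    Differentiable ℝ (fun a : Vert m π q →L[ℝ] ℝ => H.cov ⟨q, a⟩ v) := by
  obtain ⟨φ, hφ⟩ := exists_bundleChart m π q
  have e := φ.chart.left_inv hφ
  have h0 : ContMDiff 𝓘(ℝ, EuclideanSpace ℝ (Fin m) →L[ℝ] ℝ) (phaseModel m) ∞
      (fun b : EuclideanSpace ℝ (Fin m) →L[ℝ] ℝ =>
        (⟨q, b.comp (φ.vcoord q)⟩ : VCotangent m π)) := by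
    have hc : (phaseCore π).openPartialHomeomorph (phaseChart φ) (mem_range_self φ) ∈
        IsManifold.maximalAtlas (phaseModel m) ∞ (VCotangent m π) := by
      apply IsManifold.subset_maximalAtlas
      exact mem_iUnion.2 ⟨phaseChart φ, mem_iUnion.2 ⟨mem_range_self φ, rfl⟩⟩
    have h1 := contMDiffOn_symm_of_mem_maximalAtlas hc
    have h2 : ContMDiff 𝓘(ℝ, EuclideanSpace ℝ (Fin m) →L[ℝ] ℝ) (phaseModel m) ∞
        (fun b : EuclideanSpace ℝ (Fin m) →L[ℝ] ℝ => (φ.chart q, b)) :=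
      (contDiff_const.prodMk contDiff_id).contMDiff
    rw [← contMDiffOn_univ] at h2 ⊢
    refine (h1.comp h2 fun b _ => ⟨φ.chart.map_source hφ, mem_univ _⟩).congr fun b _ => ?_
    show _ = (⟨φ.chart.symm (φ.chart q), b.comp (φ.vcoord _)⟩ : VCotangent m π)
    rw [e]
  have h1 := H.smooth.comp h0
  have h2 : ContMDiff 𝓘(ℝ, EuclideanSpace ℝ (Fin m) →L[ℝ] ℝ) 𝓘(ℝ, ConfModel m).tangent ∞
      (fun _ : EuclideanSpace ℝ (Fin m) →L[ℝ] ℝ => (⟨q, v⟩ : TangentBundle 𝓘(ℝ, ConfModel m) Q)) := contMDiff_const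
  have h3 := ContMDiff.clm_bundle_apply (E₂ := Bundle.Trivial Q ℝ) (F₂ := ℝ) h1 h2
  have h4 : ContDiff ℝ ∞ (fun b : EuclideanSpace ℝ (Fin m) →L[ℝ] ℝ =>
      H.cov ⟨q, b.comp (φ.vcoord q)⟩ v) := by
    rw [← contMDiff_iff_contDiff]
    intro b
    exact (Bundle.contMDiffAt_totalSpace.1 (h3 b)).2
  have h5 : (fun a : Vert m π q →L[ℝ] ℝ => H.cov ⟨q, a⟩ v) =
      (fun b : EuclideanSpace ℝ (Fin m) →L[ℝ] ℝ => H.cov ⟨q, b.comp (φ.vcoord q)⟩ v) ∘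
        (ContinuousLinearMap.precomp ℝ (φ.vframe hφ)) := by
    ext a
    have : (a.comp (φ.vframe hφ)).comp (φ.vcoord q) = a := by
      ext v
      simp [BundleChart.vframe_vcoord hφ]
    show _ = H.cov ⟨q, (a.comp (φ.vframe hφ)).comp (φ.vcoord q)⟩ v
    rw [this]
  rw [h5]
  intro a
  have := (h4.differentiable (by simp) (ContinuousLinearMap.precomp ℝ (φ.vframe hφ) a)).hasFDerivAt
  exact ⟨_, this.comp a (ContinuousLinearMap.hasFDerivAt _)⟩

/-- The relation `qⁱ_t ∘ Ĥ = ∂ⁱℋ` holds in all bundle coordinates. -/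
theorem hamiltonianMap_coord (φ' : BundleChart m π) (p : VCotangent m π)
    (hp : p.pt ∈ φ'.chart.source) (i : Fin m) :
    (jetChart φ' (H.hamiltonianMap p)).2 i = H.dham φ' p i := by
  have hφ := (exists_bundleChart m π p.pt).choose_spec
  set φ := (exists_bundleChart m π p.pt).choose with hφdef
  obtain ⟨q, a⟩ := p
  simp only at hp hφ
  have hg : φ'.frame q (1, 0) - φ.frame q (1, 0) ∈ Vert m π q := by
    show dt m π q _ = 0
    rw [map_sub, BundleChart.dt_frame hp, BundleChart.dt_frame hφ, sub_self]
  set g : Vert m π q := ⟨_, hg⟩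
  set D := fderiv ℝ (fun a : Vert m π q →L[ℝ] ℝ => H.ham φ ⟨q, a⟩) a with hD
  have hd : HasFDerivAt (fun a : Vert m π q →L[ℝ] ℝ => H.ham φ ⟨q, a⟩) D a :=
    (((-ContinuousLinearMap.id ℝ ℝ).differentiableAt).comp a
      (H.differentiable_cov (φ.frame q (1, 0)) a)).hasFDerivAt
  have hev : HasFDerivAt (fun a : Vert m π q →L[ℝ] ℝ => a g)
      (ContinuousLinearMap.apply ℝ ℝ g : (Vert m π q →L[ℝ] ℝ) →L[ℝ] ℝ) a :=
    (ContinuousLinearMap.apply ℝ ℝ g : (Vert m π q →L[ℝ] ℝ) →L[ℝ] ℝ).hasFDerivAt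
  have heq : (fun a : Vert m π q →L[ℝ] ℝ => H.ham φ' ⟨q, a⟩) =
      fun a => H.ham φ ⟨q, a⟩ - a g := by
    ext b
    have h1 := DFunLike.congr_fun (H.cov_vert ⟨q, b⟩) g
    have h2 : H.cov ⟨q, b⟩ (φ'.frame q (1, 0) - φ.frame q (1, 0)) = b g := h1
    simp only [ham]
    rw [← h2, map_sub]
    ring
  have hd' : H.dham φ' ⟨q, a⟩ i = D ((EuclideanSpace.proj i).comp (φ'.vcoord q)) -
      φ'.vcoord q g i := by
    unfold dham
    simp only [heq]
    rw [(HasFDerivAt.fun_sub (E := Vert m π q →L[ℝ] ℝ) hd hev).fderiv]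
    rfl
  have hc : ∀ c : Vert m π q →L[ℝ] ℝ, D c =
      ∑ j, H.dham φ ⟨q, a⟩ j * c (φ.vframe hφ (EuclideanSpace.single j 1)) := by
    intro c
    have : c = ∑ j, c (φ.vframe hφ (EuclideanSpace.single j 1)) •
        ((EuclideanSpace.proj j).comp (φ.vcoord q) : Vert m π q →L[ℝ] ℝ) := by
      ext v
      have hv : v = ∑ j, (φ.vcoord q v) j • φ.vframe hφ (EuclideanSpace.single j 1) := by
        conv_lhs => rw [← BundleChart.vframe_vcoord hφ v]
        simp only [← map_smul, ← map_sum]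
        congr 1
        ext k
        simp [Finset.sum_apply, Pi.single_apply]
      conv_lhs => rw [hv]
      simp [mul_comm]
    conv_lhs => rw [this]
    simp only [map_sum, map_smul, smul_eq_mul]
    refine Finset.sum_congr rfl fun j _ => ?_
    rw [mul_comm]
    rfl
  rw [hd', hc]
  show (φ'.coord q (φ.frame q (1, WithLp.toLp 2 (H.dham φ ⟨q, a⟩)))).2 i = _
  have hsplit : ((1 : ℝ), WithLp.toLp 2 (H.dham φ ⟨q, a⟩)) =
      (1, 0) + (0, ∑ j, H.dham φ ⟨q, a⟩ j • EuclideanSpace.single j (1 : ℝ)) := by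
    refine Prod.ext (by simp) ?_
    ext k
    simp [Finset.sum_apply, Pi.single_apply]
  have hfr : φ.frame q (1, 0) = φ'.frame q (1, 0) - (g : TangentSpace 𝓘(ℝ, ConfModel m) q) := by
    simp [g]
  have hv : φ.frame q (0, ∑ j, H.dham φ ⟨q, a⟩ j • EuclideanSpace.single j (1 : ℝ)) =
      ((∑ j, H.dham φ ⟨q, a⟩ j • φ.vframe hφ (EuclideanSpace.single j 1) : Vert m π q) :
        TangentSpace 𝓘(ℝ, ConfModel m) q) := by
    rw [← Finset.sum_congr rfl (fun j _ => map_smul (φ.vframe hφ) _ _), ← map_sum]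
    rfl
  rw [hsplit, map_add, hfr, hv, map_add, map_sub, BundleChart.coord_frame hp]
  have hv2 : ∀ w : Vert m π q, (φ'.coord q (w : TangentSpace 𝓘(ℝ, ConfModel m) q)).2 =
      φ'.vcoord q w := fun w => rfl
  simp only [Prod.snd_add, Prod.snd_sub, hv2, map_sum, map_smul]
  simp [Finset.sum_apply]
  ring

end HamiltonianForm

end Mechanics

end

open Mechanics

/-!
Fix a Hamiltonian form `H` weakly associated with `L`. The section `H.cov p` of `T*Q → V*Q` restricts
to `p` on vertical vectors, so everything follows from one identity: the contraction of
`H.cov (L̂ z)` with the jet `z` itself is `ℒ z` (`HamiltonianForm.cov_legendre_vel`). In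
coordinates this says `π_i qⁱ_t - ℋ(t, q, π) = ℒ`.

The identity holds at the particular jet `z' = Ĥ(L̂ z)`, by the second condition of weak association,
and `z'` lies in the same fibre of `L̂` as `z`, by the first one. It is carried from `z'` to `z`
because `z ↦ ℒ z - H.cov (L̂ z) z` is constant on the fibres of `L̂`. On such a fibre both the base
point `q` and the momentum `p` are constant, and the derivative of the function along a curve in the
fibre is `(∂ℒ/∂qⁱ_t - p_i) dqⁱ_t = 0` (`Lagrangian.hasDerivAt_density_sub`). As `L̂` is a submersion
onto `N_L`, nearby points of a fibre are joined by smooth curves within the fibre, so the function is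
locally constant on the fibre, and the fibre is connected
(`Manifold.IsSubmersion.eq_of_hasDerivAt_zero`).

Hence `H.cov (L̂ z)` is determined by `L` (`HamiltonianForm.cov_legendre`). The three claims then
follow from the chain rule for the projections of `V*Q` and `J¹Q` to `Q`.
-/

noncomputable section

namespace Mechanics

universe u

/-! ### Functions constant on the fibres of a submersion -/

section Submersion

variable {E E' H' M N : Type*} [NormedAddCommGroup E] [NormedSpace ℝ E]
  [NormedAddCommGroup E'] [NormedSpace ℝ E'] [TopologicalSpace H'] {J : ModelWithCorners ℝ E' H'}
  [TopologicalSpace M] [ChartedSpace E M] [TopologicalSpace N] [ChartedSpace H' N] {f : M → N}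

/-- Around any point of the source of a submersion there is a chart in which the fibres are the
level sets of a linear map. -/
theorem _root_.Manifold.IsSubmersionAt.exists_chart_fibre {w : M}
    (h : Manifold.IsSubmersionAt 𝓘(ℝ, E) J ∞ f w) :
    ∃ D ∈ IsManifold.maximalAtlas 𝓘(ℝ, E) ∞ M, w ∈ D.source ∧ ∃ P : E →L[ℝ] E',
      ∀ x ∈ D.target, ∀ x' ∈ D.target, f (D.symm x) = f (D.symm x') ↔ P x = P x' := by
  refine ⟨h.domChart, h.domChart_mem_maximalAtlas, h.mem_domChart_source,
    (ContinuousLinearMap.fst ℝ E' h.complement).comp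
      (h.equiv : E →L[ℝ] E' × h.complement), ?_⟩
  have hchart : ∀ x ∈ h.domChart.target,
      h.codChart.extend J (f (h.domChart.symm x)) = (h.equiv x).1 := by
    intro x hx
    have hx' : x ∈ (h.domChart.extend 𝓘(ℝ, E)).target := by simpa using hx
    exact h.writtenInCharts hx'
  have hsource : ∀ x ∈ h.domChart.target,
      f (h.domChart.symm x) ∈ (h.codChart.extend J).source := by
    intro x hx
    rw [OpenPartialHomeomorph.extend_source]
    exact h.source_subset_preimage_source (h.domChart.map_target hx)
  intro x hx x' hx'
  rw [← (h.codChart.extend J).injOn.eq_iff (hsource x hx) (hsource x' hx'), hchart x hx,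
    hchart x' hx']
  rfl

/-- A function whose derivative vanishes along all differentiable curves contained in fibres of a
submersion is constant on the preconnected fibres. The curves are required to lie in a fibre only
near the point where the derivative is taken. -/
theorem _root_.Manifold.IsSubmersion.eq_of_hasDerivAt_zero
    (hf : Manifold.IsSubmersion 𝓘(ℝ, E) J ∞ f) {g : M → ℝ}
    (hg : ∀ (c : ℝ → M) (s : ℝ), MDifferentiableAt 𝓘(ℝ, ℝ) 𝓘(ℝ, E) c s →
      (∀ᶠ τ in nhds s, f (c τ) = f (c s)) → HasDerivAt (g ∘ c) 0 s)
    {y : N} (hy : IsPreconnected (f ⁻¹' {y})) {z z' : M} (hz : f z = y) (hz' : f z' = y) :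
    g z = g z' := by
  have hloc : IsLocallyConstant (fun w : f ⁻¹' {y} => g w) := by
    rw [IsLocallyConstant.iff_eventually_eq]
    rintro ⟨w, hw⟩
    obtain ⟨D, hD, hwD, P, hP⟩ := (hf.isSubmersionAt w).exists_chart_fibre
    obtain ⟨r, hr, hball⟩ := Metric.isOpen_iff.1 D.open_target _ (D.map_source hwD)
    have hnear : ∀ᶠ w' in nhds w, w' ∈ D.source ∧ D w' ∈ Metric.ball (D w) r :=
      Filter.Eventually.and (D.open_source.mem_nhds hwD)
        ((D.continuousAt hwD) (Metric.ball_mem_nhds _ hr))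
    filter_upwards [continuous_subtype_val.continuousAt.eventually hnear] with ⟨w', hw'⟩ ⟨h1, h2⟩
    show g w' = g w
    simp only at h1 h2
    have heq : P (D w') = P (D w) := by
      rw [← hP _ (D.map_source h1) _ (D.map_source hwD), D.left_inv h1, D.left_inv hwD]
      exact hw'.trans (Eq.symm hw)
    -- In the chart, the segment from `w` to `w'` stays in the fibre.
    let γ : ℝ → E := fun s => D w + s • (D w' - D w)
    have hγ : Differentiable ℝ γ := by fun_prop
    have hγball : ∀ s ∈ Icc (0 : ℝ) 1, γ s ∈ Metric.ball (D w) r := fun s hs =>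
      (convex_ball _ _).add_smul_sub_mem (Metric.mem_ball_self hr) h2 hs
    have hγP : ∀ s, P (γ s) = P (D w) := by
      intro s
      simp [γ, heq]
    have hder : ∀ s ∈ Icc (0 : ℝ) 1, HasDerivAt (g ∘ D.symm ∘ γ) 0 s := by
      intro s hs
      refine hg _ s ?_ ?_
      · have hsymm := ((contMDiffOn_symm_of_mem_maximalAtlas hD).contMDiffAt
          (D.open_target.mem_nhds (hball (hγball s hs)))).mdifferentiableAt (by simp)
        exact hsymm.comp s (hγ s).mdifferentiableAt
      · filter_upwards [hγ.continuous.continuousAt (Metric.isOpen_ball.mem_nhds (hγball s hs))]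
          with τ hτ
        exact (hP _ (hball hτ) _ (hball (hγball s hs))).2 ((hγP τ).trans (hγP s).symm)
    have hconst := constant_of_derivWithin_zero (f := g ∘ D.symm ∘ γ) (a := 0) (b := 1)
      (fun s hs => (hder s hs).differentiableAt.differentiableWithinAt)
      (fun s hs => (hder s ⟨hs.1, hs.2.le⟩).hasDerivWithinAt.derivWithin
        (uniqueDiffOn_Icc one_pos s ⟨hs.1, hs.2.le⟩)) 1 (by simp)
    simpa [γ, D.left_inv h1, D.left_inv hwD] using hconst
  have := isPreconnected_iff_preconnectedSpace.1 hy
  exact hloc.apply_eq_of_preconnectedSpace ⟨z, hz⟩ ⟨z', hz'⟩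

end Submersion

/-! ### Jets with fixed base point in bundle coordinates -/

variable {m : ℕ} {Q : Type u} [TopologicalSpace Q] [ChartedSpace (ConfModel m) Q]
  {π : Q → ℝ}

/-- The jet `∂_t + uⁱ ∂_i` at the point `q`. -/
def BundleChart.jet (φ : BundleChart m π) {q : Q} (hq : q ∈ φ.chart.source)
    (u : EuclideanSpace ℝ (Fin m)) : JetSpace m π :=
  ⟨q, φ.frame q (1, u), φ.dt_frame hq _⟩

theorem BundleChart.jet_addVert {φ : BundleChart m π} {q : Q} (hq : q ∈ φ.chart.source)
    (u : EuclideanSpace ℝ (Fin m)) (w : Vert m π q) :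
    (φ.jet hq u).addVert w = φ.jet hq (u + φ.vcoord q w) := by
  refine JetSpace.ext rfl ?_
  show φ.frame q (1, u) + (w : TangentSpace 𝓘(ℝ, ConfModel m) q) =
    φ.frame q (1, u + φ.vcoord q w)
  conv_lhs => rw [← vframe_vcoord hq w]
  show φ.frame q (1, u) + φ.frame q (0, φ.vcoord q w) = _
  rw [← map_add]
  simp

variable [IsManifold 𝓘(ℝ, ConfModel m) ∞ Q] [IsConfigurationBundle m π]

theorem jetChart_mem_maximalAtlas (φ : BundleChart m π) :
    (jetCore π).openPartialHomeomorph (jetChart φ) (mem_range_self φ) ∈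
      IsManifold.maximalAtlas (jetModel m) ∞ (JetSpace m π) :=
  IsManifold.subset_maximalAtlas
    (mem_iUnion.2 ⟨jetChart φ, mem_iUnion.2 ⟨mem_range_self φ, rfl⟩⟩)

namespace BundleChart

variable {φ : BundleChart m π} {q : Q}

theorem jet_jetChart {z : JetSpace m π} (hq : q ∈ φ.chart.source) (hz : z.pt = q) :
    φ.jet hq (jetChart φ z).2 = z := by
  subst hz
  have h := (jetChart φ).left_inv (x := z) hq
  have e := φ.chart.left_inv hq
  conv_rhs => rw [← h]
  show _ = jetOfCoord φ (φ.chart z.pt, (jetChart φ z).2)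
  rw [jetOfCoord_of_mem φ (by rw [e]; exact hq)]
  have key : ∀ q', q' = z.pt → ∀ h, φ.jet hq (jetChart φ z).2 =
      (⟨q', φ.frame q' (1, (jetChart φ z).2), h⟩ : JetSpace m π) := by
    rintro _ rfl h
    rfl
  exact key _ e _

theorem contMDiff_jet (hq : q ∈ φ.chart.source) :
    ContMDiff 𝓘(ℝ, EuclideanSpace ℝ (Fin m)) (jetModel m) ∞ (φ.jet hq) := by
  have h1 := contMDiffOn_symm_of_mem_maximalAtlas (jetChart_mem_maximalAtlas φ)
  have h2 : ContMDiff 𝓘(ℝ, EuclideanSpace ℝ (Fin m)) (jetModel m) ∞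
      (fun u : EuclideanSpace ℝ (Fin m) => (φ.chart q, u)) :=
    (contDiff_const.prodMk contDiff_id).contMDiff
  rw [← contMDiffOn_univ] at h2 ⊢
  refine (h1.comp h2 fun u _ => ⟨φ.chart.map_source hq, mem_univ _⟩).congr fun u _ => ?_
  have e := φ.chart.left_inv hq
  have hu : (jetChart φ (jetOfCoord φ (φ.chart q, u))).2 = u :=
    congrArg Prod.snd ((jetChart φ).right_inv (x := (φ.chart q, u))
      ⟨φ.chart.map_source hq, mem_univ _⟩)
  show _ = jetOfCoord φ (φ.chart q, u)
  conv_lhs => rw [← hu]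
  exact jet_jetChart hq (by rw [jetOfCoord_pt, e])

end BundleChart

/-! ### The Lagrangian along the fibres of the Legendre map -/

namespace Lagrangian

variable (L : Lagrangian m π) {φ : BundleChart m π} {q : Q}

/-- The relation `∂ℒ/∂qⁱ_t = π_i`, as a derivative with respect to the velocity coordinates. -/
theorem hasFDerivAt_density_jet (hq : q ∈ φ.chart.source) (u : EuclideanSpace ℝ (Fin m)) :
    HasFDerivAt (fun u => L.density (φ.jet hq u))
      ((L.legendre (φ.jet hq u)).mom.comp (φ.vframe hq)) u := by
  have hs : ContDiff ℝ ∞ (fun u => L.density (φ.jet hq u)) := by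
    rw [← contMDiff_iff_contDiff]
    exact L.smooth.comp (BundleChart.contMDiff_jet hq)
  have hd := (hs.differentiable (by simp) u).hasFDerivAt
  have hv : HasFDerivAt (fun w : Vert m π q => u + φ.vcoord q w) (φ.vcoord q) 0 :=
    (φ.vcoord q).hasFDerivAt.const_add u
  have hd0 : HasFDerivAt (fun u => L.density (φ.jet hq u))
      (fderiv ℝ (fun u => L.density (φ.jet hq u)) u) (u + φ.vcoord q 0) := by
    simpa using hd
  have hc : HasFDerivAt (fun w : Vert m π q => L.density ((φ.jet hq u).addVert w))
      ((fderiv ℝ (fun u => L.density (φ.jet hq u)) u).comp (φ.vcoord q)) 0 := by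
    simp only [BundleChart.jet_addVert]
    exact hd0.comp 0 hv
  have hm : (L.legendre (φ.jet hq u)).mom =
      (fderiv ℝ (fun u => L.density (φ.jet hq u)) u).comp (φ.vcoord q) := hc.fderiv
  have he : (L.legendre (φ.jet hq u)).mom.comp (φ.vframe hq) =
      fderiv ℝ (fun u => L.density (φ.jet hq u)) u := by
    ext w
    exact (DFunLike.congr_fun hm (φ.vframe hq w)).trans
      (congrArg _ (BundleChart.vcoord_vframe hq w))
  rw [he]
  exact hd

/-- `ℒ` minus the density of `L_H` along the graph of the Legendre map has vanishing derivative along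
every curve in a fibre of the Legendre map: there `L_H` is affine in the velocity, with the linear
part `p = ∂ℒ/∂qⁱ_t`. -/
theorem hasDerivAt_density_sub (H : HamiltonianForm m π) {c : ℝ → JetSpace m π} {s : ℝ}
    (hc : MDifferentiableAt 𝓘(ℝ, ℝ) (jetModel m) c s)
    (hL : ∀ᶠ τ in nhds s, L.legendre (c τ) = L.legendre (c s)) :
    HasDerivAt (fun τ => L.density (c τ) - H.lagrangian (L.legendre (c τ)) (c τ).vel) 0 s := by
  obtain ⟨φ, hq⟩ := exists_bundleChart m π (c s).pt
  -- A variable `q` for the base point, so that the curve `φ.jet hq (u τ)` in `J¹_q Q` has a base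
  -- point that does not depend on `τ`.
  obtain ⟨q, hqs⟩ : ∃ q, q = (c s).pt := ⟨_, rfl⟩
  rw [← hqs] at hq
  let u : ℝ → EuclideanSpace ℝ (Fin m) := fun τ => (jetChart φ (c τ)).2
  have hjet : ∀ᶠ τ in nhds s, c τ = φ.jet hq (u τ) := by
    filter_upwards [hL] with τ hτ
    exact (BundleChart.jet_jetChart hq ((congrArg VCotangent.pt hτ).trans hqs.symm)).symm
  have hs := hjet.self_of_nhds
  have hu : DifferentiableAt ℝ u s := by
    have h1 := (contMDiffOn_of_mem_maximalAtlas (jetChart_mem_maximalAtlas φ)).contMDiffAt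
      (((jetCore π).openPartialHomeomorph (jetChart φ) (mem_range_self φ)).open_source.mem_nhds
        (show c s ∈ _ from (by rw [← hqs]; exact hq : (c s).pt ∈ φ.chart.source)))
    have h2 := (h1.mdifferentiableAt (by simp)).comp s hc
    exact (mdifferentiableAt_iff_differentiableAt.1 h2).snd
  set p := L.legendre (φ.jet hq (u s)) with hp
  have hform : (fun τ => L.density (c τ) - H.lagrangian (L.legendre (c τ)) (c τ).vel) =ᶠ[nhds s]
      fun τ => L.density (φ.jet hq (u τ)) - H.cov p (φ.frame q (1, u τ)) := by
    filter_upwards [hjet, hL] with τ h1 h2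
    rw [h1, hs] at h2
    rw [h1]
    congr 1
    show H.cov ⟨q, (L.legendre (φ.jet hq (u τ))).mom⟩ (φ.frame q (1, u τ)) =
      H.cov ⟨q, (L.legendre (φ.jet hq (u s))).mom⟩ (φ.frame q (1, u τ))
    have h3 : (L.legendre (φ.jet hq (u τ))).mom = (L.legendre (φ.jet hq (u s))).mom :=
      eq_of_heq (VCotangent.ext_iff.1 h2).2
    rw [h3]
  refine HasDerivAt.congr_of_eventuallyEq ?_ hform
  have hd1 := (L.hasFDerivAt_density_jet hq (u s)).comp_hasDerivAt s hu.hasDerivAt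
  have hd2 : HasDerivAt (fun τ => H.cov p (φ.frame q (1, u τ)))
      (H.cov p (φ.frame q (0, deriv u s))) s := by
    have h1 : HasDerivAt (fun τ => ((1 : ℝ), u τ)) (0, deriv u s) s :=
      (hasDerivAt_const s (1 : ℝ)).prodMk hu.hasDerivAt
    exact ((H.cov p).comp (φ.frame q)).hasFDerivAt.comp_hasDerivAt s h1
  have h := DFunLike.congr_fun (H.cov_vert p) (φ.vframe hq (deriv u s))
  exact (hd1.fun_sub hd2).congr_deriv (sub_eq_zero.2 h.symm)

variable {L}

theorem IsAlmostRegular.density_sub_eq (hL : L.IsAlmostRegular) (H : HamiltonianForm m π)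
    {z z' : JetSpace m π} (h : L.legendre z = L.legendre z') :
    L.density z - H.lagrangian (L.legendre z) z.vel =
      L.density z' - H.lagrangian (L.legendre z') z'.vel := by
  obtain ⟨-, d, r, _, -, -, -, hsub, hconn⟩ := hL
  have hpre : L.legendreOnto ⁻¹' {L.legendreOnto z} = L.legendre ⁻¹' {L.legendre z} := by
    ext w
    exact Subtype.ext_iff
  refine hsub.eq_of_hasDerivAt_zero
    (g := fun z => L.density z - H.lagrangian (L.legendre z) z.vel) (fun c s hc hfc => ?_)
    (y := L.legendreOnto z) ?_ rfl (Subtype.ext h.symm)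
  · exact L.hasDerivAt_density_sub H hc (hfc.mono fun τ hτ => congrArg Subtype.val hτ)
  · rw [hpre]
    exact (hconn _ (mem_range_self z)).isPreconnected

theorem IsAlmostRegular.contMDiff_legendre (hL : L.IsAlmostRegular) :
    ContMDiff (jetModel m) (phaseModel m) ∞ L.legendre := by
  obtain ⟨-, d, r, _, -, hemb, -, hsub, -⟩ := hL
  exact hemb.isImmersion.contMDiff.comp hsub.contMDiff

end Lagrangian

/-! ### Hamiltonian forms on the Lagrangian constraint space -/

namespace HamiltonianForm

variable {L : Lagrangian m π} {H : HamiltonianForm m π}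

/-- Pointwise, `H` is the covector `H.cov p` pulled back along the projection `V*Q → Q`. -/
theorem form_eq (H : HamiltonianForm m π) (p : VCotangent m π) :
    H.form p = (H.cov p).comp
      (mfderiv (phaseModel m) 𝓘(ℝ, ConfModel m) (fun p : VCotangent m π => p.pt) p) := by
  have hs : MDifferentiableAt (phaseModel m) (cotangentModel m) H.sec p :=
    (H.smooth p).mdifferentiableAt (by simp)
  have hproj : MDifferentiableAt (cotangentModel m) 𝓘(ℝ, ConfModel m)
      (fun β : Cotangent m Q => β.proj) (H.sec p) :=
    (Bundle.contMDiff_proj (n := ∞) _ (H.sec p)).mdifferentiableAt (by simp)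
  have h := mfderiv_comp p hproj hs
  have h' : ((fun β : Cotangent m Q => β.proj) ∘ H.sec) = fun p => p.pt := rfl
  rw [h'] at h
  rw [h]
  rfl

/-- The projection `V*Q → Q` factors through the smooth section of `T*Q → V*Q` that defines `H`. -/
theorem mdifferentiable_pt (H : HamiltonianForm m π) :
    MDifferentiable (phaseModel m) 𝓘(ℝ, ConfModel m) (fun p : VCotangent m π => p.pt) :=
  have hproj : ContMDiff (cotangentModel m) 𝓘(ℝ, ConfModel m) ∞
      (fun β : Cotangent m Q => β.proj) := Bundle.contMDiff_proj _
  (hproj.comp H.smooth).mdifferentiable (by simp)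

theorem cov_apply_eq (H : HamiltonianForm m π) (p : VCotangent m π)
    (w : Vert m π p.pt) : H.cov p w = p.mom w :=
  DFunLike.congr_fun (H.cov_vert p) w

/-- `π_i qⁱ_t - ℋ(t, q, π) = ℒ`: the density of `L_H` on the graph of the Legendre map is `ℒ`. It holds
at the jet `Ĥ (L̂ z)` by weak association, and this jet lies in the fibre of `L̂` through `z`. -/
theorem cov_legendre_vel (hL : L.IsAlmostRegular) (hH : H.IsWeaklyAssociated L)
    (z : JetSpace m π) : H.cov (L.legendre z) z.vel = L.density z := by
  have hfix := hH.legendre_hamiltonianMap z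
  have h1 := hL.density_sub_eq H hfix
  have h2 := hH.density_eq _ (mem_range_self z)
  have h3 : H.lagrangian (L.legendre (H.hamiltonianMap (L.legendre z)))
      (H.hamiltonianMap (L.legendre z)).vel =
      H.lagrangian (L.legendre z) (H.hamiltonianMap (L.legendre z)).vel := by
    have h4 : (L.legendre (H.hamiltonianMap (L.legendre z))).mom = (L.legendre z).mom :=
      eq_of_heq (VCotangent.ext_iff.1 hfix).2
    show H.cov ⟨z.pt, (L.legendre (H.hamiltonianMap (L.legendre z))).mom⟩ _ =
      H.cov ⟨z.pt, (L.legendre z).mom⟩ _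
    rw [h4]
  rw [h3, h2, sub_self] at h1
  exact (sub_eq_zero.1 h1.symm).symm

/-- At a point of the constraint space, `H` is determined by `L`. The formula is that of the
Poincaré–Cartan form. -/
theorem cov_legendre (hL : L.IsAlmostRegular) (hH : H.IsWeaklyAssociated L)
    (z : JetSpace m π) :
    H.cov (L.legendre z) =
      (L.legendre z).mom.comp z.vertPart + L.density z • dt m π z.pt := by
  ext v
  have hv : v = (z.vertPart v : TangentSpace 𝓘(ℝ, ConfModel m) z.pt) + dt m π z.pt v • z.vel :=
    (sub_add_cancel v (dt m π z.pt v • z.vel)).symm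
  have h1 : H.cov (L.legendre z) (z.vertPart v : TangentSpace 𝓘(ℝ, ConfModel m) z.pt) =
      (L.legendre z).mom (z.vertPart v) := H.cov_apply_eq (L.legendre z) (z.vertPart v)
  have h2 := cov_legendre_vel hL hH z
  have h3 : H.cov (L.legendre z) v =
      H.cov (L.legendre z) (z.vertPart v : TangentSpace 𝓘(ℝ, ConfModel m) z.pt) +
      dt m π z.pt v * H.cov (L.legendre z) z.vel := by
    conv_lhs => rw [hv]
    exact (map_add _ _ _).trans (congrArg _ (map_smul _ _ _))
  rw [h3, h1, h2, mul_comm]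
  rfl

/-- `π_i qⁱ_t - ℒ = ℋ(t, q, π)` in all bundle coordinates. -/
theorem energy_eq_ham (hL : L.IsAlmostRegular) (hH : H.IsWeaklyAssociated L)
    (φ : BundleChart m π) (z : JetSpace m π) (hz : z.pt ∈ φ.chart.source) :
    ∑ i, (phaseChart φ (L.legendre z)).2 (EuclideanSpace.single i 1) * (jetChart φ z).2 i
      - L.density z = H.ham φ (L.legendre z) := by
  set u := (jetChart φ z).2 with hu
  have hsum : ∑ i, (phaseChart φ (L.legendre z)).2 (EuclideanSpace.single i 1) * u i =
      (L.legendre z).mom (φ.vframe hz u) := by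
    have h1 : (phaseChart φ (L.legendre z)).2 = (L.legendre z).mom.comp (φ.vframe hz) :=
      dif_pos hz
    have h2 : u = ∑ i, u i • EuclideanSpace.single i (1 : ℝ) := by
      ext k
      simp [Finset.sum_apply, Pi.single_apply]
    have h3 : ∀ a : EuclideanSpace ℝ (Fin m) →L[ℝ] ℝ,
        ∑ i, a (EuclideanSpace.single i 1) * u i = a u := by
      intro a
      conv_rhs => rw [h2, map_sum]
      exact Finset.sum_congr rfl fun i _ => by rw [map_smul, smul_eq_mul, mul_comm]
    rw [h1]
    exact h3 _
  have hvel : z.vel = φ.frame z.pt (1, 0) +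
      (φ.vframe hz u : TangentSpace 𝓘(ℝ, ConfModel m) z.pt) := by
    have h1 : (φ.jet hz u).vel = z.vel :=
      (JetSpace.ext_iff.1 (BundleChart.jet_jetChart (z := z) hz rfl)).2
    rw [← h1]
    show φ.frame z.pt (1, u) = φ.frame z.pt (1, 0) + φ.frame z.pt (0, u)
    rw [← map_add]
    simp
  have h1 : H.cov (L.legendre z) (φ.vframe hz u : TangentSpace 𝓘(ℝ, ConfModel m) z.pt) =
      (L.legendre z).mom (φ.vframe hz u) := H.cov_apply_eq (L.legendre z) (φ.vframe hz u)
  have h2 := cov_legendre_vel hL hH z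
  have h3 : H.cov (L.legendre z) z.vel = H.cov (L.legendre z) (φ.frame z.pt (1, 0)) +
      H.cov (L.legendre z) (φ.vframe hz u : TangentSpace 𝓘(ℝ, ConfModel m) z.pt) := by
    conv_lhs => rw [hvel]
    exact map_add _ _ _
  have h4 : H.ham φ (L.legendre z) = -H.cov (L.legendre z) (φ.frame z.pt (1, 0)) := rfl
  rw [hsum, h4, ← h2, h3, h1]
  ring

theorem poincareCartan_eq_pullback (hL : L.IsAlmostRegular) (hH : H.IsWeaklyAssociated L) :
    L.poincareCartan = OneForm.pullback H.form L.legendre := by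
  funext z
  have hc := mfderiv_comp z (H.mdifferentiable_pt (L.legendre z))
    ((hL.contMDiff_legendre z).mdifferentiableAt (by simp))
  have hpt : (fun p : VCotangent m π => p.pt) ∘ L.legendre = fun z : JetSpace m π => z.pt := rfl
  rw [hpt] at hc
  unfold Lagrangian.poincareCartan OneForm.pullback
  rw [H.form_eq, cov_legendre hL hH, hc]
  rfl

theorem form_eq_of_mem_constraintSpace {H' : HamiltonianForm m π} (hL : L.IsAlmostRegular)
    (hH : H.IsWeaklyAssociated L) (hH' : H'.IsWeaklyAssociated L) {p : VCotangent m π}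
    (hp : p ∈ L.constraintSpace) : H.form p = H'.form p := by
  obtain ⟨z, rfl⟩ := hp
  rw [H.form_eq, H'.form_eq, cov_legendre hL hH, cov_legendre hL hH']

end HamiltonianForm

end Mechanics

end

theorem theorem3p2 {m : ℕ} {Q : Type*} [TopologicalSpace Q] [T2Space Q]
    [SecondCountableTopology Q] [ChartedSpace (ConfModel m) Q]
    [IsManifold 𝓘(ℝ, ConfModel m) ∞ Q] (π : Q → ℝ) [IsConfigurationBundle m π]
    (L : Lagrangian m π) (hL : L.IsAlmostRegular) :
    (∀ H H' : HamiltonianForm m π, H.IsWeaklyAssociated L → H'.IsWeaklyAssociated L →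
      ∀ p ∈ L.constraintSpace, H.form p = H'.form p) ∧
    ∀ H : HamiltonianForm m π, H.IsWeaklyAssociated L →
      L.poincareCartan = OneForm.pullback H.form L.legendre ∧
      ∀ (φ : BundleChart m π) (z : JetSpace m π), z.pt ∈ φ.chart.source →
        ∑ i, (phaseChart φ (L.legendre z)).2 (EuclideanSpace.single i 1) * (jetChart φ z).2 i
          - L.density z = H.ham φ (L.legendre z) := by
  exact ⟨fun H H' hH hH' p hp => HamiltonianForm.form_eq_of_mem_constraintSpace hL hH hH' hp,
    fun H hH => ⟨HamiltonianForm.poincareCartan_eq_pullback hL hH,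
      fun φ z hz => HamiltonianForm.energy_eq_ham hL hH φ z hz⟩⟩
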